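/- Consider $\lambda$-terms in de Bruijn notation, with de Bruijn indices $\underline{1},\underline{2},\underline{3},\dots$: every index $\underline{i}$ ($i\ge 1$) is a term, if $M$ is a term then so is the abstraction $\lambda M$, and if $M,N$ are terms then so is the application $MN$. Terms need not be closed. Each term is encoded as a binary word by $$\widehat{\underline{i}}=1^i0,\qquad \widehat{\lambda M}=00\,\widehat{M},\qquad \widehat{MN}=01\,\widehat{M}\,\widehat{N},$$ and the size of a term is the length of its encoding, i.e. $|\underline{i}|=i+1$, $|\lambda M|=|M|+2$, $|MN|=|M|+|N|+2$. For every $n\ge 0$ there are only finitely many terms of size $n$; let $S_{\infty,n}$ denote their number. The polynomial $1-z-2z^2+2z^3-3z^4-z^5$ has a real root $\rho$ whose modulus is strictly smaller than that of every other complex root, and there is a real constant $C$ such that $$S_{\infty,n}\sim C\cdot\rho^{-n}\cdot n^{-3/2}\qquad(n\to\infty),$$ that is, the ratio of the two sides tends to $1$. Numerically, $\rho\doteq 0.509308127$, $1/\rho\doteq 1.963447954$ and $C\doteq 1.021874073$, where $x\doteq d$ means that $d$ is $x$ correctly rounded to nine decimal places, i.e. $|x-d|<5\cdot10^{-10}$.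 -/

import Mathlib

namespace BinaryLambda

/-- De Bruijn terms of the λ-calculus, with de Bruijn indices `1, 2, 3, …`; free indices
are allowed, so the terms need not be closed. -/
inductive Term : Type
  | var (i : ℕ+) : Term
  | abs (M : Term) : Term
  | app (M N : Term) : Term

/-- Tromp's binary encoding (`false` is the bit 0, `true` is the bit 1):
`code (λ M) = 00 code M`, `code (M N) = 01 code M code N`, `code i = 1^i 0`. -/
def Term.code : Term → List Bool
  | .var i => List.replicate (i : ℕ) true ++ [false]
  | .abs M => false :: false :: M.code
  | .app M N => false :: true :: (M.code ++ N.code)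

/-- The binary size of a term: the length of its binary encoding. -/
def Term.size (M : Term) : ℕ := M.code.length

theorem Term.size_var (i : ℕ+) : (Term.var i).size = (i : ℕ) + 1 := by
  simp [Term.size, Term.code]

theorem Term.size_abs (M : Term) : (Term.abs M).size = M.size + 2 := by
  simp [Term.size, Term.code]

theorem Term.size_app (M N : Term) : (Term.app M N).size = M.size + N.size + 2 := by
  simp [Term.size, Term.code]

/-- The set of all (not necessarily closed) terms of size `n`. -/
def termsOfSize (n : ℕ) : Set Term := {M | M.size = n}

/-- The number `S_{∞,n}` of all (not necessarily closed) terms of size `n`. -/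
noncomputable def numTerms (n : ℕ) : ℕ := (termsOfSize n).ncard

/-- The polynomial function `1 - z - 2z² + 2z³ - 3z⁴ - z⁵` on the complex numbers. -/
def R (z : ℂ) : ℂ := 1 - z - 2 * z ^ 2 + 2 * z ^ 3 - 3 * z ^ 4 - z ^ 5

end BinaryLambda

/-!
Counting terms by their outermost constructor gives for the generating function `S = ∑ S_{∞,n} Xⁿ`
the quadratic equation `S = X² (1 / (1 - X) + S + S²)`. Its discriminant is governed by `R`: the
formal power series `Y = 1 - X² - 2 X² S` satisfies `(1 - X) Y² = R`
(`BinaryLambda.one_sub_X_mul_discrRoot_sq`), so the coefficients of `S` are those of a square root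
that is singular at the smallest root `ρ` of `R`.

The singularity is analysed with formal power series only. With `α = 1 / ρ` one has
`(1 - X) R = (1 - α X) (1 + g)` for an explicit polynomial `g`, the `cofactor`, and for `r = 11 / 20`,
which exceeds `ρ`, the sum `∑ |gₖ| rᵏ` is less than `1`. This inequality is used twice.

* It forces every root of `R` other than `ρ` out of the disc of radius `r`
  (`BinaryLambda.lt_norm_of_R_eq_zero`).
* Write `Y = √(1 - α X) f`. Then `V = (1 - X) f` satisfies `V² = 1 + g`, and the recursion
  `2 u = g - u²` for `u = V - 1` shows that `∑ |uₖ| rᵏ ≤ 1` (`sum_abs_coeff_le_one_of_sq_eq`). Hence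
  the coefficients of `f` are `O(r ^ (-n))`, and its value at `ρ` satisfies
  `((1 - ρ) f(ρ))² = 1 + g(ρ)`.

The coefficients of `√(1 - α X)` are Catalan numbers up to scaling, so that Stirling's formula gives
their asymptotics `-ρ ^ (-n) n ^ (-3/2) / (2 √π)` (`tendsto_coeff_sqrtOneSub`). Multiplication by `f`
is a convolution with a sequence that is exponentially smaller, which multiplies the constant by
`f(ρ)` (`tendsto_convolution_mul_rpow`). Thus `S_{∞,n} ∼ C ρ ^ (-n) n ^ (-3/2)` with
`C = f(ρ) / (4 √π ρ²)`. The counts are nonnegative, so `C ≥ 0`, and `C` is determined by its square,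
an explicit expression in `ρ` and `π`, from which the numerical value follows.
-/

/-! ### Sequences asymptotic to a power of `n` -/

section

open Filter Topology

/-- `catalan n ∼ 4 ^ n * n ^ (-3/2) / √π`, from Stirling's formula. -/
theorem tendsto_catalan :
    Tendsto (fun n : ℕ => (catalan n : ℝ) / 4 ^ n * (n : ℝ) ^ (3 / 2 : ℝ)) atTop
      (𝓝 (1 / √Real.pi)) := by
  have hs := Stirling.tendsto_stirlingSeq_sqrt_pi
  have hpi : √Real.pi ≠ 0 := by positivity
  have h2 : Tendsto (fun n : ℕ => 2 * n) atTop atTop :=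
    tendsto_id.const_mul_atTop' (by norm_num)
  have hq : Tendsto (fun n : ℕ => Stirling.stirlingSeq (2 * n) / Stirling.stirlingSeq n ^ 2)
      atTop (𝓝 (1 / √Real.pi)) := by
    have := (hs.comp h2).div (hs.pow 2) (by positivity)
    have e : √Real.pi / √Real.pi ^ 2 = 1 / √Real.pi := by field_simp
    rwa [e] at this
  have hn : Tendsto (fun n : ℕ => (n : ℝ) / (n + 1)) atTop (𝓝 1) :=
    tendsto_natCast_div_add_atTop 1
  have := hq.mul hn
  rw [mul_one] at this
  refine this.congr' ?_
  filter_upwards [eventually_gt_atTop 0] with n hn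
  have hn' : (0 : ℝ) < n := by exact_mod_cast hn
  have hcat : (catalan n : ℝ) = ((2 * n).factorial : ℝ) / (n.factorial : ℝ) ^ 2 / (n + 1) := by
    have h1 : ((n : ℝ) + 1) * catalan n = n.centralBinom := by
      exact_mod_cast succ_mul_catalan_eq_centralBinom n
    have h3 : ((n.centralBinom : ℕ) : ℝ) * (n.factorial) ^ 2 = ((2 * n).factorial : ℝ) := by
      have := Nat.choose_mul_factorial_mul_factorial (n := 2 * n) (k := n) (by omega)
      rw [show 2 * n - n = n by omega, ← Nat.centralBinom_eq_two_mul_choose] at this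
      rw [← this]; push_cast; ring
    rw [← h3, ← h1]
    field_simp
  have hrp : (n : ℝ) ^ (3 / 2 : ℝ) = n * √n := by
    rw [show (3 / 2 : ℝ) = 1 + 1 / 2 by norm_num, Real.rpow_add hn', Real.rpow_one,
      ← Real.sqrt_eq_rpow]
  rw [hcat, hrp, Stirling.stirlingSeq, Stirling.stirlingSeq]
  have e1 : √(2 * ((2 * n : ℕ) : ℝ)) = 2 * √n := by
    rw [show (2 * ((2 * n : ℕ) : ℝ)) = 2 ^ 2 * n by push_cast; ring,
      Real.sqrt_mul (by positivity), Real.sqrt_sq (by norm_num)]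
  have e2 : √(2 * (n : ℝ)) ^ 2 = 2 * n := Real.sq_sqrt (by positivity)
  have e3 : √(n : ℝ) ^ 2 = n := Real.sq_sqrt hn'.le
  have e4 : (((2 * n : ℕ) : ℝ) / Real.exp 1) ^ (2 * n) = 4 ^ n * ((n / Real.exp 1) ^ n) ^ 2 := by
    rw [pow_mul, ← pow_mul _ n 2, mul_comm n 2, pow_mul _ 2 n, ← mul_pow]
    congr 1; push_cast; ring
  have e5 : 0 < ((n : ℝ) / Real.exp 1) ^ n := by positivity
  have e6 : 0 < √(n : ℝ) := by positivity
  rw [e1, e4]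
  generalize ((n : ℝ) / Real.exp 1) ^ n = E at *
  rw [div_pow, mul_pow, e2]
  field_simp
  rw [e3]

theorem tendsto_add_natCast_rpow {a : ℕ → ℝ} {L p : ℝ}
    (ha : Tendsto (fun n : ℕ => a n * (n : ℝ) ^ p) atTop (𝓝 L)) (k : ℕ) :
    Tendsto (fun n : ℕ => a n * ((n + k : ℕ) : ℝ) ^ p) atTop (𝓝 L) := by
  have h1 : Tendsto (fun n : ℕ => (((n : ℝ) / (n + k))⁻¹) ^ p) atTop (𝓝 1) := by
    have := ((tendsto_natCast_div_add_atTop (k : ℝ)).inv₀ one_ne_zero).rpow_const (p := p)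
      (Or.inl (by norm_num))
    simpa using this
  have h2 := ha.mul h1
  rw [mul_one] at h2
  refine h2.congr' ?_
  filter_upwards [eventually_gt_atTop 0] with n hn
  have hn' : (0 : ℝ) < n := by exact_mod_cast hn
  rw [mul_assoc, ← Real.mul_rpow hn'.le (by positivity)]
  congr 2
  push_cast
  field_simp

theorem tendsto_mul_rpow_of_add_natCast {a : ℕ → ℝ} {L p : ℝ} (k : ℕ)
    (ha : Tendsto (fun n : ℕ => a n * ((n + k : ℕ) : ℝ) ^ p) atTop (𝓝 L)) :
    Tendsto (fun n : ℕ => a n * (n : ℝ) ^ p) atTop (𝓝 L) := by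
  have h1 : Tendsto (fun n : ℕ => ((n : ℝ) / (n + k)) ^ p) atTop (𝓝 1) := by
    simpa using (tendsto_natCast_div_add_atTop (k : ℝ)).rpow_const (p := p)
      (Or.inl one_ne_zero)
  have h2 := ha.mul h1
  rw [mul_one] at h2
  refine h2.congr' ?_
  filter_upwards [eventually_gt_atTop 0] with n hn
  have hn' : (0 : ℝ) < n := by exact_mod_cast hn
  rw [mul_assoc, ← Real.mul_rpow (by positivity) (by positivity)]
  congr 2
  push_cast
  field_simp

theorem exists_abs_le_of_tendsto_rpow {a : ℕ → ℝ} {L p : ℝ}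
    (ha : Tendsto (fun n : ℕ => a n * (n : ℝ) ^ p) atTop (𝓝 L)) :
    ∃ B : ℝ, ∀ n : ℕ, |a n| * ((n + 1 : ℕ) : ℝ) ^ p ≤ B := by
  obtain ⟨B, hB⟩ := (tendsto_add_natCast_rpow ha 1).abs.bddAbove_range
  refine ⟨B, fun n => ?_⟩
  have : |a n * ((n + 1 : ℕ) : ℝ) ^ p| ≤ B := hB ⟨n, rfl⟩
  rwa [abs_mul, abs_of_nonneg (a := ((n + 1 : ℕ) : ℝ) ^ p) (by positivity)] at this

/-- Convolving a sequence asymptotic to `L * n ^ (-p)` with a rapidly decreasing sequence only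
multiplies the constant by the sum of the latter. This is dominated convergence, with the bound
`n ≤ (k + 1) * (n - k + 1)` controlling the ratio of the powers. -/
theorem tendsto_convolution_mul_rpow {a g : ℕ → ℝ} {L p : ℝ} (hp : 0 ≤ p)
    (ha : Tendsto (fun n : ℕ => a n * (n : ℝ) ^ p) atTop (𝓝 L))
    (hg : Summable fun k : ℕ => |g k| * ((k + 1 : ℕ) : ℝ) ^ p) :
    Tendsto (fun n : ℕ =>
      (∑ q ∈ Finset.HasAntidiagonal.antidiagonal n, g q.1 * a q.2) * (n : ℝ) ^ p) atTop
      (𝓝 (L * ∑' k, g k)) := by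
  obtain ⟨B, hB⟩ := exists_abs_le_of_tendsto_rpow ha
  have hB0 : 0 ≤ B := le_trans (by positivity) (hB 0)
  have key : Tendsto (fun n : ℕ => ∑' k, if k ≤ n then g k * a (n - k) * (n : ℝ) ^ p else 0)
      atTop (𝓝 (∑' k, L * g k)) := by
    refine tendsto_tsum_of_dominated_convergence (hg.mul_left B) (fun k => ?_)
      (Eventually.of_forall fun n k => ?_)
    · rw [← tendsto_add_atTop_iff_nat k]
      have := (tendsto_add_natCast_rpow ha k).const_mul (g k)
      rw [mul_comm L]
      refine this.congr fun n => ?_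
      rw [if_pos (by omega), Nat.add_sub_cancel, mul_assoc]
    · split_ifs with h
      · have h1 : (n : ℝ) ^ p ≤ ((k + 1 : ℕ) : ℝ) ^ p * ((n - k + 1 : ℕ) : ℝ) ^ p := by
          rw [← Real.mul_rpow (by positivity) (by positivity)]
          refine Real.rpow_le_rpow (by positivity) ?_ hp
          obtain ⟨m, rfl⟩ := Nat.exists_eq_add_of_le h
          rw [Nat.add_sub_cancel_left]
          have : k + m ≤ (k + 1) * (m + 1) := by nlinarith
          exact_mod_cast this
        rw [norm_mul, norm_mul, Real.norm_eq_abs, Real.norm_eq_abs,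
          Real.norm_of_nonneg (by positivity)]
        calc |g k| * |a (n - k)| * (n : ℝ) ^ p
            ≤ |g k| * |a (n - k)| * (((k + 1 : ℕ) : ℝ) ^ p * ((n - k + 1 : ℕ) : ℝ) ^ p) := by
              gcongr
          _ = (|g k| * ((k + 1 : ℕ) : ℝ) ^ p) * (|a (n - k)| * ((n - k + 1 : ℕ) : ℝ) ^ p) := by
              ring
          _ ≤ (|g k| * ((k + 1 : ℕ) : ℝ) ^ p) * B := by gcongr; exact hB _
          _ = B * (|g k| * ((k + 1 : ℕ) : ℝ) ^ p) := mul_comm _ _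
      · rw [norm_zero]; positivity
  rw [tsum_mul_left] at key
  refine key.congr fun n => ?_
  rw [tsum_eq_sum (s := Finset.range (n + 1)), Finset.Nat.sum_antidiagonal_eq_sum_range_succ_mk,
    Finset.sum_mul]
  · refine Finset.sum_congr rfl fun k hk => ?_
    rw [if_pos (by simpa [Nat.lt_succ_iff] using hk)]
  · intro k hk
    rw [if_neg (by simpa [Nat.lt_succ_iff] using hk)]

theorem summable_abs_mul_rpow_of_le_geometric {g : ℕ → ℝ} {q M p : ℝ} (m : ℕ) (hpm : p ≤ m)
    (hq0 : 0 < q) (hq1 : q < 1) (hg : ∀ k, |g k| ≤ M * q ^ k) :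
    Summable fun k : ℕ => |g k| * ((k + 1 : ℕ) : ℝ) ^ p := by
  have h0 : Summable fun k : ℕ => (k : ℝ) ^ m * q ^ k :=
    summable_pow_mul_geometric_of_norm_lt_one m (by rwa [Real.norm_of_nonneg hq0.le])
  have h1 : Summable fun k : ℕ => M * (((k + 1 : ℕ) : ℝ) ^ m * q ^ (k + 1) * q⁻¹) :=
    (((summable_nat_add_iff 1).2 h0).mul_right _).mul_left _
  refine h1.of_nonneg_of_le (fun k => by positivity) fun k => ?_
  have h2 : ((k + 1 : ℕ) : ℝ) ^ p ≤ ((k + 1 : ℕ) : ℝ) ^ m := by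
    rw [← Real.rpow_natCast]
    exact Real.rpow_le_rpow_of_exponent_le (by push_cast; linarith [k.cast_nonneg (α := ℝ)]) hpm
  calc |g k| * ((k + 1 : ℕ) : ℝ) ^ p ≤ (M * q ^ k) * ((k + 1 : ℕ) : ℝ) ^ m :=
        mul_le_mul (hg k) h2 (by positivity) ((abs_nonneg _).trans (hg k))
    _ = _ := by field_simp; ring

end

/-! ### Formal power series with a square-root singularity -/

section

open Filter Topology PowerSeries

/-- The formal square root `√(1 - c X)` over `ℝ`. With `F` the Catalan series, `F = 1 + X F²`, the
formal square root of `1 - 4 X` is `1 - 2 X F`; then `X` is rescaled by `c / 4`. -/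
noncomputable def sqrtOneSub (c : ℝ) : ℝ⟦X⟧ :=
  rescale (c / 4) (1 - 2 * X * catalanSeries.map (Nat.castRingHom ℝ))

theorem sqrtOneSub_sq (c : ℝ) : sqrtOneSub c ^ 2 = 1 - C c * X := by
  have h : (catalanSeries.map (Nat.castRingHom ℝ)) ^ 2 * X + 1 =
      catalanSeries.map (Nat.castRingHom ℝ) := by
    have := congrArg (PowerSeries.map (Nat.castRingHom ℝ)) catalanSeries_sq_mul_X_add_one
    simpa using this
  have h2 : (1 - 2 * X * catalanSeries.map (Nat.castRingHom ℝ)) ^ 2 = 1 - 4 * (X : ℝ⟦X⟧) := by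
    linear_combination 4 * X * h
  rw [sqrtOneSub, ← map_pow, h2, map_sub, map_mul, rescale_X, map_one, map_ofNat, ← mul_assoc,
    ← map_ofNat (C (R := ℝ)) 4, ← map_mul]
  congr 3
  ring

theorem constantCoeff_sqrtOneSub (c : ℝ) : constantCoeff (sqrtOneSub c) = 1 := by
  rw [sqrtOneSub, ← coeff_zero_eq_constantCoeff_apply, coeff_rescale]
  simp

theorem coeff_succ_sqrtOneSub (c : ℝ) (n : ℕ) :
    coeff (n + 1) (sqrtOneSub c) = -(2 * catalan n * (c / 4) ^ (n + 1)) := by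
  rw [sqrtOneSub, coeff_rescale, map_sub, mul_right_comm, coeff_succ_mul_X, coeff_one,
    if_neg n.succ_ne_zero, ← map_ofNat (C (R := ℝ)) 2, coeff_C_mul, coeff_map,
    catalanSeries_coeff]
  simp only [eq_natCast]
  ring

/-- If `f ^ 2 = 1 + g` has constant coefficient `1` and the coefficients of `g` satisfy
`∑ |gₖ| rᵏ ≤ 1`, then the nonconstant coefficients of `f` satisfy the same bound. Writing
`f = 1 + u`, the partial sums `s` of `∑ |uₖ| rᵏ` stay below `1` because `2 u = g - u ^ 2` bounds the
next one by `(1 + s ^ 2) / 2`. -/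
theorem sum_abs_coeff_le_one_of_sq_eq {f g : ℝ⟦X⟧} {r : ℝ} (hr : 0 ≤ r)
    (h0 : constantCoeff f = 1) (hf : f ^ 2 = 1 + g)
    (hg : ∀ n, ∑ k ∈ Finset.range n, |coeff k g| * r ^ k ≤ 1) (n : ℕ) :
    ∑ k ∈ Finset.range n, |coeff k (f - 1)| * r ^ k ≤ 1 := by
  have hu : C 2 * (f - 1) = g - (f - 1) * (f - 1) := by
    rw [map_ofNat]
    linear_combination hf
  set u := f - 1 with hu_def
  have hu0 : coeff 0 u = 0 := by simp [hu_def, h0]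
  set w : ℕ → ℝ := fun k => |coeff k u| * r ^ k with hw
  have hw0 : w 0 = 0 := by simp [hw, hu0]
  have hwn : ∀ k, 0 ≤ w k := fun k => by positivity
  have hcoeff : ∀ k, 2 * w k ≤ |coeff k g| * r ^ k +
      ∑ p ∈ Finset.HasAntidiagonal.antidiagonal k, w p.1 * w p.2 := by
    intro k
    have h1 := congrArg (coeff k) hu
    rw [coeff_C_mul, map_sub (coeff k) g, coeff_mul] at h1
    have h2 : 2 * |coeff k u| ≤ |coeff k g| +
        ∑ p ∈ Finset.HasAntidiagonal.antidiagonal k, |coeff p.1 u| * |coeff p.2 u| := by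
      rw [← abs_two, ← abs_mul, h1]
      refine (abs_sub _ _).trans (add_le_add_right ?_ _)
      refine (Finset.abs_sum_le_sum_abs _ _).trans_eq ?_
      simp only [abs_mul]
    calc 2 * w k = (2 * |coeff k u|) * r ^ k := by simp only [hw]; ring
      _ ≤ _ := mul_le_mul_of_nonneg_right h2 (by positivity)
      _ = _ := by
        rw [add_mul, Finset.sum_mul]
        congr 1
        refine Finset.sum_congr rfl fun p hp => ?_
        rw [← Finset.HasAntidiagonal.mem_antidiagonal.1 hp, pow_add]
        simp only [hw]
        ring
  -- products `w i * w j` with `i + j ≤ m` have `i, j < m`, unless one factor is `w 0 = 0`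
  have hconv : ∀ m, ∑ k ∈ Finset.range (m + 1),
      ∑ p ∈ Finset.HasAntidiagonal.antidiagonal k, w p.1 * w p.2 ≤
        (∑ k ∈ Finset.range m, w k) ^ 2 := by
    intro m
    rw [sq, Finset.sum_mul_sum, ← Finset.sum_product']
    refine le_trans (Finset.sum_le_sum fun k hk => ?_)
      (Finset.sum_fiberwise_le_sum_of_sum_fiber_nonneg (t := Finset.range (m + 1))
        (g := fun p : ℕ × ℕ => p.1 + p.2)
        fun k _ => Finset.sum_nonneg fun p _ => mul_nonneg (hwn _) (hwn _))
    refine (Finset.sum_subset (fun p hp => ?_) fun p hp hp' => ?_).ge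
    · simpa using (Finset.mem_filter.1 hp).2
    · have hp1 : p.1 + p.2 = k := by simpa using hp
      have hkm : k < m + 1 := by simpa using hk
      rcases Nat.eq_zero_or_pos p.1 with h | h
      · rw [h, hw0, zero_mul]
      rcases Nat.eq_zero_or_pos p.2 with h' | h'
      · rw [h', hw0, mul_zero]
      refine absurd ?_ hp'
      simp only [Finset.mem_filter, Finset.mem_product, Finset.mem_range]
      omega
  induction n with
  | zero => simp
  | succ m ih =>
    have h1 : 2 * ∑ k ∈ Finset.range (m + 1), w k ≤ 1 + (∑ k ∈ Finset.range m, w k) ^ 2 := by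
      rw [Finset.mul_sum]
      refine (Finset.sum_le_sum fun k _ => hcoeff k).trans ?_
      rw [Finset.sum_add_distrib]
      exact add_le_add (hg _) (hconv m)
    have h2 : 0 ≤ ∑ k ∈ Finset.range m, w k := Finset.sum_nonneg fun k _ => hwn k
    have h3 : ∑ k ∈ Finset.range m, w k ≤ 1 := ih
    change ∑ k ∈ Finset.range (m + 1), w k ≤ 1
    nlinarith

theorem tsum_coeff_mul {f g : ℝ⟦X⟧} {x : ℝ} (hf : Summable fun k => ‖coeff k f * x ^ k‖)
    (hg : Summable fun k => ‖coeff k g * x ^ k‖) :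
    ∑' k, coeff k (f * g) * x ^ k = (∑' k, coeff k f * x ^ k) * ∑' k, coeff k g * x ^ k := by
  rw [tsum_mul_tsum_eq_tsum_sum_antidiagonal_of_summable_norm hf hg]
  refine tsum_congr fun n => ?_
  rw [coeff_mul, Finset.sum_mul]
  refine Finset.sum_congr rfl fun p hp => ?_
  rw [← Finset.HasAntidiagonal.mem_antidiagonal.1 hp, pow_add]
  ring

theorem tsum_coeff_coe_polynomial (p : Polynomial ℝ) (x : ℝ) :
    ∑' k, coeff k (p : ℝ⟦X⟧) * x ^ k = p.eval x := by
  rw [Polynomial.eval_eq_sum_range, tsum_eq_sum (s := Finset.range (p.natDegree + 1))]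
  · simp
  · intro k hk
    rw [Polynomial.coeff_coe, Polynomial.coeff_eq_zero_of_natDegree_lt (by simpa using hk),
      zero_mul]

theorem summable_coeff_coe_polynomial (p : Polynomial ℝ) (x : ℝ) :
    Summable fun k => ‖coeff k (p : ℝ⟦X⟧) * x ^ k‖ := by
  refine summable_of_ne_finset_zero (s := Finset.range (p.natDegree + 1)) fun k hk => ?_
  rw [Polynomial.coeff_coe, Polynomial.coeff_eq_zero_of_natDegree_lt (by simpa using hk),
    zero_mul, norm_zero]

/-- The coefficients of `√(1 - X / ρ)` are asymptotic to `-ρ ^ (-n) * n ^ (-3/2) / (2 √π)`. -/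
theorem tendsto_coeff_sqrtOneSub {ρ α : ℝ} (hα : α * ρ = 1) :
    Tendsto (fun n : ℕ => coeff n (sqrtOneSub α) * ρ ^ n * (n : ℝ) ^ (3 / 2 : ℝ)) atTop
      (𝓝 (-(1 / (2 * √Real.pi)))) := by
  rw [← tendsto_add_atTop_iff_nat 1]
  have h := (tendsto_add_natCast_rpow tendsto_catalan 1).const_mul (-1 / 2)
  have e : -1 / 2 * (1 / √Real.pi) = -(1 / (2 * √Real.pi)) := by field_simp
  rw [e] at h
  refine h.congr fun n => ?_
  rw [coeff_succ_sqrtOneSub, div_pow, pow_succ 4 n]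
  have : α ^ (n + 1) * ρ ^ (n + 1) = 1 := by rw [← mul_pow, hα, one_pow]
  generalize ((n + 1 : ℕ) : ℝ) ^ (3 / 2 : ℝ) = s
  field_simp
  linear_combination (4 * catalan n * s) * this

/-- If `(1 - X) f` has constant coefficient `1` and square `1 + g` with `∑ |gₖ| rᵏ ≤ 1`, then the
coefficients of `f` are `O(r ^ (-n))`. -/
theorem abs_coeff_mul_pow_le_two {f g : ℝ⟦X⟧} {r : ℝ} (hr0 : 0 ≤ r) (hr1 : r ≤ 1)
    (h0 : constantCoeff f = 1) (hf : ((1 - X) * f) ^ 2 = 1 + g)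
    (hg : ∀ n, ∑ k ∈ Finset.range n, |coeff k g| * r ^ k ≤ 1) (n : ℕ) :
    |coeff n f| * r ^ n ≤ 2 := by
  set v := (1 - X) * f with hv
  have hfv : f = v * mk 1 := by
    rw [hv, mul_right_comm, mul_comm (1 - X), mk_one_mul_one_sub_eq_one, one_mul]
  have hv0 : constantCoeff v = 1 := by simp [hv, h0]
  have hb := sum_abs_coeff_le_one_of_sq_eq hr0 hv0 hf hg (n + 1)
  have h1 : coeff n f = ∑ k ∈ Finset.range (n + 1), coeff k v := by
    rw [hfv, coeff_mul, Finset.Nat.sum_antidiagonal_eq_sum_range_succ_mk]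
    simp
  have h2 : ∑ k ∈ Finset.range (n + 1), |coeff k (1 : ℝ⟦X⟧)| * r ^ k = 1 := by
    rw [Finset.sum_eq_single 0]
    · simp
    · intro k _ hk
      simp [coeff_one, hk]
    · simp
  calc |coeff n f| * r ^ n ≤ (∑ k ∈ Finset.range (n + 1), |coeff k v|) * r ^ n := by
        rw [h1]
        gcongr
        exact Finset.abs_sum_le_sum_abs _ _
    _ ≤ ∑ k ∈ Finset.range (n + 1), (|coeff k (1 : ℝ⟦X⟧)| * r ^ k + |coeff k (v - 1)| * r ^ k) := by
        rw [Finset.sum_mul]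
        refine Finset.sum_le_sum fun k hk => ?_
        rw [← add_mul]
        refine mul_le_mul ?_ (pow_le_pow_of_le_one hr0 hr1 (by simpa [Nat.lt_succ_iff] using hk))
          (by positivity) (by positivity)
        have : coeff k v = coeff k (1 : ℝ⟦X⟧) + coeff k (v - 1) := by
          rw [← map_add, add_sub_cancel]
        rw [this]
        exact abs_add_le _ _
    _ ≤ 2 := by rw [Finset.sum_add_distrib, h2]; linarith

theorem summable_coeff_mul_pow_of_le {f : ℝ⟦X⟧} {r ρ M : ℝ} (hρ : 0 < ρ) (hρr : ρ < r)
    (hf : ∀ k, |coeff k f| * r ^ k ≤ M) {p : ℝ} (m : ℕ) (hpm : p ≤ m) :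
    Summable fun k : ℕ => |coeff k f * ρ ^ k| * ((k + 1 : ℕ) : ℝ) ^ p := by
  have hr : 0 < r := hρ.trans hρr
  refine summable_abs_mul_rpow_of_le_geometric (q := ρ / r) (M := M) m hpm (by positivity)
    ((div_lt_one hr).2 hρr) fun k => ?_
  rw [abs_mul, abs_of_nonneg (by positivity : 0 ≤ ρ ^ k), div_pow]
  calc |coeff k f| * ρ ^ k = (|coeff k f| * r ^ k) * (ρ ^ k / r ^ k) := by field_simp
    _ ≤ _ := by gcongr; exact hf k

/-- Transfer theorem: a power series with a square-root singularity at `ρ`. If `y = √(1 - X / ρ) f`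
and `(1 - X) f` is a square root of a polynomial `1 + g` with `∑ |gₖ| rᵏ ≤ 1` for some
`ρ < r ≤ 1`, then `yₙ ρⁿ n ^ (3/2)` tends to `-f(ρ) / (2 √π)`, and `f(ρ)` is determined up to sign
by `((1 - ρ) f(ρ)) ^ 2 = 1 + g(ρ)`. -/
theorem exists_tendsto_coeff_sqrtOneSub_mul {f : ℝ⟦X⟧} {g : Polynomial ℝ} {ρ α r : ℝ}
    (hα : α * ρ = 1) (hρ : 0 < ρ) (hρr : ρ < r) (hr1 : r ≤ 1) (h0 : constantCoeff f = 1)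
    (hf : ((1 - X) * f) ^ 2 = 1 + (g : ℝ⟦X⟧))
    (hg : ∀ n, ∑ k ∈ Finset.range n, |g.coeff k| * r ^ k ≤ 1) :
    ∃ s : ℝ, ((1 - ρ) * s) ^ 2 = 1 + g.eval ρ ∧
      Tendsto (fun n : ℕ => coeff n (sqrtOneSub α * f) * ρ ^ n * (n : ℝ) ^ (3 / 2 : ℝ)) atTop
        (𝓝 (-(1 / (2 * √Real.pi)) * s)) := by
  have hb := abs_coeff_mul_pow_le_two (hρ.trans hρr).le hr1 h0 hf
    (by simpa only [Polynomial.coeff_coe] using hg)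
  have hsum : Summable fun k => ‖coeff k f * ρ ^ k‖ := by
    simpa using summable_coeff_mul_pow_of_le hρ hρr hb (p := 0) 0 (by simp)
  refine ⟨∑' k, coeff k f * ρ ^ k, ?_, ?_⟩
  · have e1 : ((1 - X) * f) ^ 2 = ((((1 - Polynomial.X) ^ 2 : Polynomial ℝ)) : ℝ⟦X⟧) * (f * f) := by
      push_cast
      ring
    have hff : Summable fun k => ‖coeff k (f * f) * ρ ^ k‖ := by
      refine (summable_norm_sum_mul_antidiagonal_of_summable_norm hsum hsum).congr fun n => ?_
      rw [coeff_mul, Finset.sum_mul]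
      congr 1
      refine Finset.sum_congr rfl fun p hp => ?_
      rw [← Finset.HasAntidiagonal.mem_antidiagonal.1 hp, pow_add]
      ring
    have e2 : (1 : ℝ⟦X⟧) + (g : ℝ⟦X⟧) = ((1 + g : Polynomial ℝ) : ℝ⟦X⟧) := by push_cast; rfl
    have h := tsum_coeff_mul (summable_coeff_coe_polynomial ((1 - Polynomial.X) ^ 2) ρ) hff
    rw [← e1, hf, e2, tsum_coeff_coe_polynomial, tsum_coeff_coe_polynomial,
      tsum_coeff_mul hsum hsum] at h
    simp only [Polynomial.eval_add, Polynomial.eval_one, Polynomial.eval_pow, Polynomial.eval_sub,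
      Polynomial.eval_X] at h
    rw [h]
    ring
  · refine (tendsto_convolution_mul_rpow (by norm_num) (tendsto_coeff_sqrtOneSub hα)
      (summable_coeff_mul_pow_of_le hρ hρr hb (p := 3 / 2) 2 (by norm_num))).congr fun n => ?_
    congr 1
    rw [mul_comm (sqrtOneSub α), coeff_mul, Finset.sum_mul]
    refine Finset.sum_congr rfl fun p hp => ?_
    rw [← Finset.HasAntidiagonal.mem_antidiagonal.1 hp, pow_add]
    ring

end

namespace BinaryLambda

/-! ### Counting terms -/

theorem termsOfSize_zero : termsOfSize 0 = ∅ := by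
  ext M
  cases M <;> simp [termsOfSize, Term.size_var, Term.size_abs, Term.size_app]

theorem termsOfSize_one : termsOfSize 1 = ∅ := by
  ext M
  cases M <;> simp [termsOfSize, Term.size_var, Term.size_abs, Term.size_app]

/-- A term of size `n + 2` is the index `n + 1`, an abstraction of a term of size `n`, or an
application of two terms whose sizes add up to `n`. -/
theorem termsOfSize_add_two (n : ℕ) :
    termsOfSize (n + 2) = {Term.var n.succPNat} ∪ (Term.abs '' termsOfSize n ∪
      ⋃ p ∈ Finset.HasAntidiagonal.antidiagonal n,
        (fun q : Term × Term => Term.app q.1 q.2) '' (termsOfSize p.1 ×ˢ termsOfSize p.2)) := by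
  ext M
  cases M with
  | var i =>
    simp only [termsOfSize, Term.size_var, Set.mem_ofPred_eq, Set.mem_union, Set.mem_singleton_iff,
      Term.var.injEq, Set.mem_image, Set.mem_iUnion, reduceCtorEq, and_false, exists_false,
      or_false, ← PNat.coe_inj, Nat.succPNat_coe]
    omega
  | abs M =>
    simp [termsOfSize, Term.size_abs]
  | app M N =>
    simp only [termsOfSize, Term.size_app, Set.mem_ofPred_eq, Set.mem_union, Set.mem_singleton_iff,
      Set.mem_image, Set.mem_iUnion, reduceCtorEq, and_false, exists_false, false_or,
      Set.mem_prod, Prod.exists, Term.app.injEq, Finset.HasAntidiagonal.mem_antidiagonal]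
    constructor
    · intro h
      exact ⟨M.size, N.size, by omega, M, N, ⟨rfl, rfl⟩, rfl, rfl⟩
    · rintro ⟨i, j, hij, M', N', ⟨rfl, rfl⟩, rfl, rfl⟩
      omega

theorem termsOfSize_finite (n : ℕ) : (termsOfSize n).Finite := by
  induction n using Nat.strong_induction_on with
  | _ n ih =>
    match n, ih with
    | 0, _ => simp [termsOfSize_zero]
    | 1, _ => simp [termsOfSize_one]
    | n + 2, ih =>
      rw [termsOfSize_add_two]
      refine (Set.finite_singleton _).union (((ih n (by omega)).image _).union ?_)
      refine (Finset.HasAntidiagonal.antidiagonal n).finite_toSet.biUnion fun p hp => ?_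
      have hp' : p.1 + p.2 = n := by simpa using hp
      exact ((ih _ (by omega)).prod (ih _ (by omega))).image _

theorem numTerms_zero : numTerms 0 = 0 := by simp [numTerms, termsOfSize_zero]

theorem numTerms_one : numTerms 1 = 0 := by simp [numTerms, termsOfSize_one]

theorem ncard_iUnion_app (n : ℕ) :
    (⋃ p ∈ Finset.HasAntidiagonal.antidiagonal n, (fun q : Term × Term => Term.app q.1 q.2) ''
      (termsOfSize p.1 ×ˢ termsOfSize p.2)).ncard =
    ∑ p ∈ Finset.HasAntidiagonal.antidiagonal n, numTerms p.1 * numTerms p.2 := by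
  have hinj : Function.Injective (fun q : Term × Term => Term.app q.1 q.2) := by
    rintro ⟨a, b⟩ ⟨c, d⟩ h
    simpa using h
  have hd : (↑(Finset.HasAntidiagonal.antidiagonal n) : Set (ℕ × ℕ)).PairwiseDisjoint
      (fun p => (fun q : Term × Term => Term.app q.1 q.2) ''
        (termsOfSize p.1 ×ˢ termsOfSize p.2)) := by
    intro p _ q _ hpq
    refine (Set.disjoint_image_iff hinj).2 (Set.disjoint_left.2 ?_)
    rintro ⟨M, N⟩ ⟨h1, h2⟩ ⟨h3, h4⟩
    exact hpq (Prod.ext (h1.symm.trans h3) (h2.symm.trans h4))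
  refine (Set.Finite.ncard_biUnion (Finset.finite_toSet _)
    (fun p _ => ((termsOfSize_finite _).prod (termsOfSize_finite _)).image _) hd).trans ?_
  rw [finsum_mem_coe_finset]
  refine Finset.sum_congr rfl fun p _ => ?_
  rw [Set.ncard_image_of_injective _ hinj, Set.ncard_prod, numTerms, numTerms]

theorem numTerms_add_two (n : ℕ) :
    numTerms (n + 2) =
      1 + (numTerms n + ∑ p ∈ Finset.HasAntidiagonal.antidiagonal n, numTerms p.1 * numTerms p.2) := by
  have hfin : (⋃ p ∈ Finset.HasAntidiagonal.antidiagonal n,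
      (fun q : Term × Term => Term.app q.1 q.2) '' (termsOfSize p.1 ×ˢ termsOfSize p.2)).Finite :=
    (Finset.HasAntidiagonal.antidiagonal n).finite_toSet.biUnion fun p _ =>
      ((termsOfSize_finite _).prod (termsOfSize_finite _)).image _
  have habs := (termsOfSize_finite n).image Term.abs
  rw [numTerms, termsOfSize_add_two, Set.ncard_union_eq _ (Set.finite_singleton _)
    (habs.union hfin), Set.ncard_singleton, Set.ncard_union_eq _ habs hfin, ncard_iUnion_app,
    Set.ncard_image_of_injective _ (fun _ _ h => Term.abs.inj h), numTerms]
  · rw [Set.disjoint_left]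
    rintro _ ⟨M, _, rfl⟩
    simp
  · simp

section

open Filter Topology PowerSeries

/-! ### The generating function and its discriminant -/

/-- The generating function `∑ S_{∞,n} Xⁿ` of all terms. -/
noncomputable def termSeries : ℝ⟦X⟧ := PowerSeries.mk fun n => (numTerms n : ℝ)

theorem termSeries_eq :
    termSeries = X ^ 2 * (PowerSeries.mk 1 + termSeries + termSeries * termSeries) := by
  ext n
  match n with
  | 0 => simp [termSeries, numTerms_zero]
  | 1 => simp [termSeries, numTerms_one, coeff_X_pow_mul']
  | n + 2 =>
    rw [coeff_X_pow_mul, map_add, map_add, coeff_mul]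
    simp only [termSeries, coeff_mk, numTerms_add_two, Pi.one_apply]
    push_cast
    ring

/-- The formal square root `1 - X² - 2 X² S` of the discriminant of the quadratic equation
`X² S² - (1 - X²) S + X² / (1 - X) = 0` for the generating function `S` of all terms. -/
noncomputable def discrRoot : ℝ⟦X⟧ := 1 - X ^ 2 - 2 * X ^ 2 * termSeries

theorem one_sub_X_mul_discrRoot_sq :
    (1 - X) * discrRoot ^ 2 = 1 - X - 2 * X ^ 2 + 2 * X ^ 3 - 3 * X ^ 4 - X ^ 5 := by
  have h := termSeries_eq
  have h1 := mk_one_mul_one_sub_eq_one ℝ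
  rw [discrRoot]
  linear_combination -4 * X ^ 2 * (1 - X) * h - 4 * X ^ 4 * h1

theorem constantCoeff_discrRoot : constantCoeff discrRoot = 1 := by
  simp [discrRoot]

theorem coeff_discrRoot (n : ℕ) : coeff (n + 3) discrRoot = -2 * numTerms (n + 1) := by
  have h : discrRoot = 1 - X ^ 2 - X ^ 2 * (C 2 * termSeries) := by
    rw [discrRoot, map_ofNat]
    ring
  rw [h, map_sub, map_sub, show n + 3 = n + 1 + 2 by ring, coeff_X_pow_mul, coeff_C_mul,
    coeff_one, coeff_X_pow, if_neg (by omega), if_neg (by omega), termSeries, coeff_mk]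
  ring

/-- With `α = 1 / ρ` for a root `ρ` of `R`, the polynomial `g` such that
`(1 - z) R(z) = (1 - α z) (1 + g(z))`. -/
noncomputable def cofactor (α : ℝ) : Polynomial ℝ :=
  Polynomial.C (α - 2) * Polynomial.X + Polynomial.C (α ^ 2 - 2 * α - 1) * Polynomial.X ^ 2 +
  Polynomial.C (α ^ 3 - 2 * α ^ 2 - α + 4) * Polynomial.X ^ 3 +
  Polynomial.C (α ^ 4 - 2 * α ^ 3 - α ^ 2 + 4 * α - 5) * Polynomial.X ^ 4 -
  Polynomial.C (α ^ 4 - α ^ 3 - 2 * α ^ 2 + 2 * α - 3) * Polynomial.X ^ 5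

theorem one_sub_mul_R {α : ℝ} (hα : α ^ 5 - α ^ 4 - 2 * α ^ 3 + 2 * α ^ 2 - 3 * α - 1 = 0) (w : ℂ) :
    (1 - w) * R w = (1 - α * w) * (1 + (cofactor α).aeval w) := by
  have h : (α : ℂ) ^ 5 - α ^ 4 - 2 * α ^ 3 + 2 * α ^ 2 - 3 * α - 1 = 0 := by exact_mod_cast hα
  simp only [R, cofactor, map_add, map_sub, map_mul, Polynomial.aeval_C, Polynomial.aeval_X,
    map_pow, Complex.coe_algebraMap, map_one, map_ofNat]
  linear_combination (w ^ 5 - w ^ 6) * h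

theorem one_sub_X_mul_discrRoot_sq_eq {α : ℝ}
    (hα : α ^ 5 - α ^ 4 - 2 * α ^ 3 + 2 * α ^ 2 - 3 * α - 1 = 0) :
    ((1 - X) * discrRoot) ^ 2 = (1 - C α * X) * (1 + (cofactor α : ℝ⟦X⟧)) := by
  have h := congrArg (C (R := ℝ)) hα
  have h1 := one_sub_X_mul_discrRoot_sq
  simp only [map_add, map_sub, map_mul, map_pow, map_one, map_ofNat, map_zero] at h
  simp only [cofactor, Polynomial.coe_add, Polynomial.coe_sub, Polynomial.coe_mul,
    Polynomial.coe_pow, Polynomial.coe_C, Polynomial.coe_X]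
  simp only [map_add, map_sub, map_mul, map_pow, map_one, map_ofNat]
  linear_combination (1 - X) * h1 + (X ^ 5 - X ^ 6) * h

/-- The radius `11 / 20` lies strictly between `ρ ≈ 0.5093` and the point near `0.6` where the sum
reaches `1`. -/
theorem sum_abs_coeff_cofactor_lt {α : ℝ} (h1 : 1.963447 < α) (h2 : α < 1.963449) (n : ℕ) :
    ∑ k ∈ Finset.range n, |(cofactor α).coeff k| * (11 / 20) ^ k < 1 := by
  have h6 : ∀ k, 6 ≤ k → (cofactor α).coeff k = 0 := by
    intro k hk
    have : ∀ j, j < 6 → k ≠ j := fun j hj => by omega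
    simp only [cofactor, Polynomial.coeff_add, Polynomial.coeff_sub, Polynomial.coeff_C_mul,
      Polynomial.coeff_X_pow, Polynomial.coeff_X]
    simp [this, (this 1 (by norm_num)).symm]
  calc ∑ k ∈ Finset.range n, |(cofactor α).coeff k| * (11 / 20 : ℝ) ^ k
      ≤ ∑ k ∈ Finset.range (max 6 n), |(cofactor α).coeff k| * (11 / 20 : ℝ) ^ k :=
        Finset.sum_le_sum_of_subset_of_nonneg (Finset.range_mono (le_max_right _ _))
          fun _ _ _ => by positivity
    _ = ∑ k ∈ Finset.range 6, |(cofactor α).coeff k| * (11 / 20 : ℝ) ^ k := by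
        refine (Finset.sum_subset (Finset.range_mono (le_max_left _ _)) fun k _ hk => ?_).symm
        rw [h6 k (by simpa using hk), abs_zero, zero_mul]
    _ < 1 := by
        have a2 : 3.855124 < α ^ 2 ∧ α ^ 2 < 3.855133 := by constructor <;> nlinarith
        have a3 : 7.569331 < α ^ 3 ∧ α ^ 3 < 7.569358 := by
          rw [pow_succ]; constructor <;> nlinarith [a2.1, a2.2]
        have a4 : 14.86198 < α ^ 4 ∧ α ^ 4 < 14.86206 := by
          rw [pow_succ]; constructor <;> nlinarith [a3.1, a3.2]
        have c1 : |α - 2| ≤ 0.0366 := by rw [abs_le]; constructor <;> linarith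
        have c2 : |α ^ 2 - 2 * α - 1| ≤ 1.072 := by
          rw [abs_le]; constructor <;> linarith [a2.1, a2.2]
        have c3 : |α ^ 3 - 2 * α ^ 2 - α + 4| ≤ 1.896 := by
          rw [abs_le]; constructor <;> linarith [a2.1, a2.2, a3.1, a3.2]
        have c4 : |α ^ 4 - 2 * α ^ 3 - α ^ 2 + 4 * α - 5| ≤ 1.28 := by
          rw [abs_le]; constructor <;> linarith [a2.1, a2.2, a3.1, a3.2, a4.1, a4.2]
        have c5 : |3 - (α ^ 4 - α ^ 3 - 2 * α ^ 2 + 2 * α)| ≤ 0.51 := by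
          rw [abs_le]; constructor <;> linarith [a2.1, a2.2, a3.1, a3.2, a4.1, a4.2]
        simp only [cofactor, Finset.sum_range_succ, Finset.sum_range_zero, Polynomial.coeff_add,
          Polynomial.coeff_sub, Polynomial.coeff_C_mul, Polynomial.coeff_X_pow, Polynomial.coeff_X]
        norm_num
        linarith

/-! ### Roots, asymptotics and numerical values -/

/-- Every root `w` of `R` other than `1 / α` lies outside the disc of radius `11 / 20`, because the
cofactor satisfies `|g(w)| < 1` on that disc. -/
theorem lt_norm_of_R_eq_zero {ρ α : ℝ} (hαρ : α * ρ = 1)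
    (hα : α ^ 5 - α ^ 4 - 2 * α ^ 3 + 2 * α ^ 2 - 3 * α - 1 = 0)
    (h1 : 1.963447 < α) (h2 : α < 1.963449) {w : ℂ} (hw : R w = 0) (hne : w ≠ ρ) :
    11 / 20 < ‖w‖ := by
  by_contra! hle
  have h := one_sub_mul_R hα w
  rw [hw, mul_zero] at h
  rcases mul_eq_zero.1 h.symm with h | h
  · refine hne ?_
    have hαρ' : (α : ℂ) * ρ = 1 := by exact_mod_cast hαρ
    have hα0 : (α : ℂ) ≠ 0 := left_ne_zero_of_mul_eq_one hαρ'
    exact mul_left_cancel₀ hα0 (by rw [hαρ']; linear_combination -h)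
  · have h3 : ‖(cofactor α).aeval w‖ = 1 := by
      rw [eq_neg_of_add_eq_zero_right h, norm_neg, norm_one]
    have h4 : ‖(cofactor α).aeval w‖ ≤
        ∑ k ∈ Finset.range ((cofactor α).natDegree + 1), |(cofactor α).coeff k| * (11 / 20) ^ k := by
      rw [Polynomial.aeval_eq_sum_range]
      refine (norm_sum_le _ _).trans (Finset.sum_le_sum fun k _ => ?_)
      rw [norm_smul, norm_pow, Real.norm_eq_abs]
      gcongr
    linarith [sum_abs_coeff_cofactor_lt h1 h2 ((cofactor α).natDegree + 1)]

/-- With `α = 1 / ρ`, all powers of `α` in `g(ρ)` cancel, which leaves a polynomial in `ρ` suited to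
numerical evaluation. -/
theorem eval_cofactor {ρ α : ℝ} (hαρ : α * ρ = 1) :
    1 + (cofactor α).eval ρ =
      5 - 9 * ρ - 2 * ρ ^ 2 + 10 * ρ ^ 3 - 7 * ρ ^ 4 + 3 * ρ ^ 5 := by
  have hρ : ρ ≠ 0 := right_ne_zero_of_mul_eq_one hαρ
  obtain rfl : α = 1 / ρ := by field_simp; exact hαρ
  simp only [cofactor, Polynomial.eval_add, Polynomial.eval_sub, Polynomial.eval_mul,
    Polynomial.eval_C, Polynomial.eval_X, Polynomial.eval_pow]
  field_simp
  ring

/-- The transfer theorem applied to the generating function: `discrRoot = √(1 - X / ρ) f`, where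
`((1 - X) f) ^ 2 = 1 + g` with `g` the cofactor. The transfer theorem gives `f(ρ)` up to sign; the
sign of the constant `c` is that of the counts. -/
theorem exists_tendsto_numTerms {ρ α : ℝ} (hαρ : α * ρ = 1) (hρ : 0 < ρ)
    (hρr : ρ < 11 / 20) (hα : α ^ 5 - α ^ 4 - 2 * α ^ 3 + 2 * α ^ 2 - 3 * α - 1 = 0)
    (h1 : 1.963447 < α) (h2 : α < 1.963449) :
    ∃ c : ℝ, 0 ≤ c ∧
      c ^ 2 * (16 * Real.pi * (ρ ^ 4 * (1 - ρ) ^ 2)) =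
        5 - 9 * ρ - 2 * ρ ^ 2 + 10 * ρ ^ 3 - 7 * ρ ^ 4 + 3 * ρ ^ 5 ∧
      Tendsto (fun n : ℕ => (numTerms n : ℝ) * ρ ^ n * (n : ℝ) ^ (3 / 2 : ℝ)) atTop (𝓝 c) := by
  have hT0 : constantCoeff (sqrtOneSub α) ≠ 0 := by simp [constantCoeff_sqrtOneSub]
  have hT : sqrtOneSub α ≠ 0 := by
    intro h
    simp [h] at hT0
  set f := discrRoot * (sqrtOneSub α)⁻¹ with hf
  have hfT : sqrtOneSub α * f = discrRoot := by
    rw [hf, mul_left_comm, PowerSeries.mul_inv_cancel _ hT0, mul_one]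
  have hf0 : constantCoeff f = 1 := by
    simp [hf, constantCoeff_discrRoot, constantCoeff_sqrtOneSub]
  have hfsq : ((1 - X) * f) ^ 2 = 1 + (cofactor α : ℝ⟦X⟧) := by
    refine mul_left_cancel₀ (pow_ne_zero 2 hT) ?_
    rw [← mul_pow, mul_left_comm, hfT, one_sub_X_mul_discrRoot_sq_eq hα, sqrtOneSub_sq]
  obtain ⟨s, hs, hlim⟩ := exists_tendsto_coeff_sqrtOneSub_mul hαρ hρ hρr (by norm_num) hf0 hfsq
    fun n => (sum_abs_coeff_cofactor_lt h1 h2 n).le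
  rw [hfT] at hlim
  have hpi : 0 < √Real.pi := by positivity
  have hlim2 : Tendsto (fun n : ℕ => (numTerms n : ℝ) * ρ ^ n * (n : ℝ) ^ (3 / 2 : ℝ)) atTop
      (𝓝 (s / (4 * √Real.pi * ρ ^ 2))) := by
    refine tendsto_mul_rpow_of_add_natCast 2 ?_
    -- `coeff_discrRoot` needs the exponent to be at least `3`, past the terms of `1 - X ^ 2`
    rw [← tendsto_add_atTop_iff_nat 1]
    have h3 := ((tendsto_add_atTop_iff_nat 3).2 hlim).const_mul (-(1 / (2 * ρ ^ 2)))
    have e : -(1 / (2 * ρ ^ 2)) * (-(1 / (2 * √Real.pi)) * s) = s / (4 * √Real.pi * ρ ^ 2) := by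
      field_simp
      ring
    rw [e] at h3
    refine h3.congr fun n => ?_
    rw [coeff_discrRoot, show n + 3 = n + 1 + 2 by ring, pow_add ρ (n + 1) 2]
    field_simp
  refine ⟨_, ge_of_tendsto' hlim2 fun n => by positivity, ?_, hlim2⟩
  rw [← eval_cofactor hαρ, ← hs, div_pow, mul_pow, mul_pow, Real.sq_sqrt Real.pi_pos.le]
  have := Real.pi_pos
  field_simp
  ring

/-- Fifteen decimal places of `ρ`, more than enough to obtain nine of the constant. -/
theorem exists_R_root : ∃ ρ : ℝ, 0.509308127024237 ≤ ρ ∧ ρ ≤ 0.509308127024238 ∧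
    1 - ρ - 2 * ρ ^ 2 + 2 * ρ ^ 3 - 3 * ρ ^ 4 - ρ ^ 5 = 0 := by
  have hc : ContinuousOn (fun x : ℝ => 1 - x - 2 * x ^ 2 + 2 * x ^ 3 - 3 * x ^ 4 - x ^ 5)
      (Set.Icc 0.509308127024237 0.509308127024238) := by fun_prop
  obtain ⟨ρ, hρ, h⟩ := intermediate_value_Icc' (by norm_num) hc
    (show (0 : ℝ) ∈ Set.Icc _ _ by constructor <;> norm_num)
  exact ⟨ρ, hρ.1, hρ.2, h⟩

/-- The numerical value of the constant, from enclosures of both sides of the equation for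
`c ^ 2`; the powers of `ρ`, `1 - ρ` and `π` are bounded one by one. -/
theorem abs_constant_sub_lt {ρ c : ℝ} (h1 : 0.509308127024237 ≤ ρ) (h2 : ρ ≤ 0.509308127024238)
    (hc0 : 0 ≤ c) (hc : c ^ 2 * (16 * Real.pi * (ρ ^ 4 * (1 - ρ) ^ 2)) =
      5 - 9 * ρ - 2 * ρ ^ 2 + 10 * ρ ^ 3 - 7 * ρ ^ 4 + 3 * ρ ^ 5) :
    |c - 1.021874073| < 5 / 10 ^ 10 := by
  have hρ0 : (0 : ℝ) ≤ ρ := by linarith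
  have hρ1 : (0 : ℝ) ≤ 1 - ρ := by linarith
  have lo : ∀ k : ℕ, (0.509308127024237 : ℝ) ^ k ≤ ρ ^ k :=
    fun k => pow_le_pow_left₀ (by norm_num) h1 k
  have hi : ∀ k : ℕ, ρ ^ k ≤ (0.509308127024238 : ℝ) ^ k := fun k => pow_le_pow_left₀ hρ0 h2 k
  have qlo : (1 - 0.509308127024238 : ℝ) ^ 2 ≤ (1 - ρ) ^ 2 :=
    pow_le_pow_left₀ (by norm_num) (by linarith) 2
  have qhi : (1 - ρ) ^ 2 ≤ (1 - 0.509308127024237 : ℝ) ^ 2 :=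
    pow_le_pow_left₀ hρ1 (by linarith) 2
  have plo : (3.14159265358979 : ℝ) ≤ Real.pi := by linarith [Real.pi_gt_d20]
  have phi : Real.pi ≤ (3.14159265358980 : ℝ) := by linarith [Real.pi_lt_d20]
  have l2 := lo 2; have l3 := lo 3; have l4 := lo 4; have l5 := lo 5
  have u2 := hi 2; have u3 := hi 3; have u4 := hi 4; have u5 := hi 5
  have dlo : 16 * 3.14159265358979 * ((0.509308127024237 : ℝ) ^ 4 *
      (1 - 0.509308127024238) ^ 2) ≤ 16 * Real.pi * (ρ ^ 4 * (1 - ρ) ^ 2) := by gcongr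
  have dhi : 16 * Real.pi * (ρ ^ 4 * (1 - ρ) ^ 2) ≤ 16 * 3.14159265358980 *
      ((0.509308127024238 : ℝ) ^ 4 * (1 - 0.509308127024237) ^ 2) := by gcongr
  generalize 16 * Real.pi * (ρ ^ 4 * (1 - ρ) ^ 2) = D at *
  rw [abs_sub_lt_iff]
  norm_num at l2 l3 l4 l5 u2 u3 u4 u5 dlo dhi ⊢
  constructor
  · by_contra! h
    have h3 : (1.0218740735 : ℝ) ^ 2 ≤ c ^ 2 := pow_le_pow_left₀ (by norm_num) (by linarith) 2
    have h4 := mul_le_mul h3 dlo (by norm_num) (by positivity)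
    norm_num at h4
    linarith
  · by_contra! h
    have h3 : c ^ 2 ≤ (1.0218740725 : ℝ) ^ 2 := pow_le_pow_left₀ hc0 (by linarith) 2
    have h4 := mul_le_mul h3 dhi (le_trans (by norm_num) dlo) (by positivity)
    norm_num at h4
    linarith

end

end BinaryLambda

theorem mainTheorem1 :
    (∀ n : ℕ, (BinaryLambda.termsOfSize n).Finite) ∧
    ∃ ρ C : ℝ,
      -- `ρ` is the root of smallest modulus of the polynomial
      (BinaryLambda.R (ρ : ℂ) = 0 ∧
        ∀ w : ℂ, BinaryLambda.R w = 0 → w ≠ (ρ : ℂ) → ‖(ρ : ℂ)‖ < ‖w‖) ∧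
      -- the numerical values, correct to nine decimal places
      |ρ - 0.509308127| < 5 / 10 ^ 10 ∧
      |1 / ρ - 1.963447954| < 5 / 10 ^ 10 ∧
      |C - 1.021874073| < 5 / 10 ^ 10 ∧
      Asymptotics.IsEquivalent Filter.atTop
        (fun n : ℕ => (BinaryLambda.numTerms n : ℝ))
        (fun n : ℕ => C * ρ ^ (-(n : ℤ)) * (n : ℝ) ^ (-(3 / 2) : ℝ)) := by
  refine ⟨BinaryLambda.termsOfSize_finite, ?_⟩
  obtain ⟨ρ, h1, h2, hR⟩ := BinaryLambda.exists_R_root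
  have hρ : 0 < ρ := by linarith
  have hρ0 : ρ ≠ 0 := hρ.ne'
  have hαρ : 1 / ρ * ρ = 1 := by field_simp
  have hα : (1 / ρ) ^ 5 - (1 / ρ) ^ 4 - 2 * (1 / ρ) ^ 3 + 2 * (1 / ρ) ^ 2 - 3 * (1 / ρ) - 1 = 0 := by
    field_simp
    linear_combination hR
  have hα1 : 1.9634479540 < 1 / ρ := by rw [lt_div_iff₀ hρ]; linarith
  have hα2 : 1 / ρ < 1.9634479541 := by rw [div_lt_iff₀ hρ]; linarith
  obtain ⟨c, hc0, hc, hlim⟩ := BinaryLambda.exists_tendsto_numTerms hαρ hρ (by linarith) hα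
    (by linarith) (by linarith)
  have hcabs := BinaryLambda.abs_constant_sub_lt h1 h2 hc0 hc
  refine ⟨ρ, c, ⟨?_, fun w hw hne => ?_⟩, ?_, ?_, hcabs, ?_⟩
  · rw [BinaryLambda.R]
    exact_mod_cast hR
  · have := BinaryLambda.lt_norm_of_R_eq_zero hαρ hα (by linarith) (by linarith) hw hne
    rw [Complex.norm_real, Real.norm_of_nonneg hρ.le]
    linarith
  · rw [abs_sub_lt_iff]; constructor <;> linarith
  · rw [abs_sub_lt_iff]; constructor <;> linarith
  · have hcpos : 0 < c := by linarith [(abs_sub_lt_iff.1 hcabs).2]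
    refine Asymptotics.isEquivalent_of_tendsto_one ?_
    have h := hlim.div_const c
    rw [div_self hcpos.ne'] at h
    refine h.congr fun n => ?_
    rw [Pi.div_apply, Real.rpow_neg n.cast_nonneg, zpow_neg, zpow_natCast]
    simp only [div_eq_mul_inv, mul_inv, inv_inv]
    ring
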